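/- Let $X$ be a finite abelian group with at least two elements, and let $(X,\{R_0,\dots,R_n\})$ be a (commutative) translation association scheme on $X$, that is, $(x,y)\in R_i \iff (x+z,y+z)\in R_i$; let $X_i=\{x : (0,x)\in R_i\}$ and let $v_i=|X_i|$ be the valency of $R_i$. Let $d: X\times X\to\mathbb{R}_{\ge 0}$ satisfy the triangle inequality and be constant on each relation, with value $d(i)$ on $R_i$ (so the scheme is weakly metric for $d$), and suppose that $d$ is graphical: whenever $d(x,y)>1$ there is $z$ with $d(x,z)=d(x,y)-1$ and $d(z,y)=1$. For $e \geq 0$ put $\Pi(e)=|\{i : 0\le d(i)\le e\}|$. Fix an inner product on $X$, i.e. an isomorphism $y\mapsto\langle y,\cdot\rangle$ from $X$ onto its group of complex characters. Let the dual partition of $X$ be the one in which $y,y'$ lie in the same class iff $\sum_{x\in X_i}\langle y,x\rangle=\sum_{x\in X_i}\langle y',x\rangle$ for all $i$; its classes $X_\gamma^*$ define the relations $R^*_\gamma=\{(a,b): b-a\in X^*_\gamma\}$ of the dual scheme. Let $Y$ be a subgroup of $X$, let $Y^\perp=\{x\in X : \langle y,x\rangle=1 \text{ for all } y\in Y\}$,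 and let $s$ be the number of relations of the dual scheme, other than the diagonal one, that occur between elements of $Y$. Let $e'$ be the packing radius of $Y^\perp$: the largest integer $e\ge 0$ such that the balls $\{y: d(y,c)\le e\}$, $c\in Y^\perp$, are pairwise disjoint (assumed to exist when $|Y^\perp|>1$; if $|Y^\perp|=1$, $e'$ may be any nonnegative integer). The generalized external distance of a code $C\subseteq X$ with packing radius $e$ is $s'(C)-\Pi(e)+e+1$, where $s'(C)$ is the classical external distance, i.e. the number of nontrivial classes $X^*_\gamma$ with $\frac{1}{|C|}\sum_{x,y\in C}\sum_{u\in X^*_\gamma}\langle u,y-x\rangle\neq 0$. Then the generalized external distance of $Y^\perp$ is $\mu'=s-\Pi(e')+e'+1$, and $$|Y|\le\sum_{i:\ d(i)\le\mu'} v_i .$$ Moreover, if the scheme is self-dual through the inner product (the dual partition is $\{X_0,\dots,X_n\}$), then $s$ is the number of relations $R_i$, $i\ne 0$, that occur between elements of $Y$. -/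

import Mathlib

open scoped BigOperators

/-- A commutative association scheme with `n` classes on a finite set `X`: relations
`R_0, ..., R_n` forming a partition of `X × X` (into nonempty parts) with `R_0` the diagonal,
closed under inversion, with intersection numbers `p i j k = p_{ij}^k = p_{ji}^k`. -/
structure AssocScheme (X : Type*) (n : ℕ) where
  /-- `rel i x y` means `(x, y) ∈ R_i`. -/
  rel : Fin (n + 1) → X → X → Prop
  nonempty : ∀ i, ∃ x y, rel i x y
  partition : ∀ x y, ∃! i, rel i x y
  diag : ∀ x y, rel 0 x y ↔ x = y
  /-- `R_{inv i}` is the inverse relation of `R_i`. -/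
  inv : Fin (n + 1) → Fin (n + 1)
  rel_inv : ∀ i x y, rel (inv i) x y ↔ rel i y x
  /-- the intersection numbers -/
  p : Fin (n + 1) → Fin (n + 1) → Fin (n + 1) → ℕ
  p_comm : ∀ i j k, p i j k = p j i k
  card_eq : ∀ i j k x y, rel k x y → {z : X | rel i x z ∧ rel j z y}.ncard = p i j k

namespace AssocScheme

variable {X : Type*} {n : ℕ}

/-- The valency `v_i` of the `i`-th relation: the number of `y` with `(x, y) ∈ R_i`, for any
`x` (see `ncard_rel_eq_valency`). -/
def valency (R : AssocScheme X n) (i : Fin (n + 1)) : ℕ := R.p i (R.inv i) 0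

theorem ncard_rel_eq_valency (R : AssocScheme X n) (i : Fin (n + 1)) (x : X) :
    {y : X | R.rel i x y}.ncard = R.valency i := by
  have h := R.card_eq i (R.inv i) 0 x x ((R.diag x x).2 rfl)
  simpa [R.rel_inv, valency] using h

/-- The scheme is weakly metric for `d`: `d` is a nonnegative function satisfying the triangle
inequality which takes the constant value `δ i` on the relation `R_i`. Symmetry and
`d x x = 0` are not needed; in particular every genuine distance is allowed. -/
structure IsWeaklyMetric (R : AssocScheme X n) (d : X → X → ℝ) (δ : Fin (n + 1) → ℝ) :
    Prop where
  nonneg : ∀ x y, 0 ≤ d x y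
  triangle : ∀ x y z, d x z ≤ d x y + d y z
  const : ∀ i x y, R.rel i x y → d x y = δ i

/-- The number of relations `R_i`, `i ≠ 0`, occurring between elements of `Y`. -/
noncomputable def degree (R : AssocScheme X n) (Y : Set X) : ℕ :=
  {i : Fin (n + 1) | i ≠ 0 ∧ ∃ a ∈ Y, ∃ b ∈ Y, R.rel i a b}.ncard

variable [AddCommGroup X]

/-- A translation scheme on an additive abelian group. -/
def IsTranslation (R : AssocScheme X n) : Prop :=
  ∀ i x y z, R.rel i x y ↔ R.rel i (x + z) (y + z)

/-- The class `X_i = {x | (0, x) ∈ R_i}` of a translation scheme. -/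
def cls (R : AssocScheme X n) (i : Fin (n + 1)) : Set X := {x | R.rel i 0 x}

/-- The dual partition of the character group: two characters are in the same class of the dual
scheme iff every adjacency matrix has the same eigenvalue `∑_{x ∈ X_i} χ(x)` at both, i.e. iff
they lie in the same common eigenspace of the Bose-Mesner algebra. -/
noncomputable def dualSetoid (R : AssocScheme X n) : Setoid (AddChar X ℂ) where
  r χ ψ := ∀ i, ∑ᶠ x ∈ R.cls i, χ x = ∑ᶠ x ∈ R.cls i, ψ x
  iseqv := ⟨fun _ _ => rfl, fun h i => (h i).symm, fun h h' i => (h i).trans (h' i)⟩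

/-- The index set of the classes of the dual scheme
(equivalently, of the primitive idempotents `E_γ = |X|⁻¹ [∑_{χ ∈ γ} χ (y - x)]_{x,y}`). -/
abbrev DualClass (R : AssocScheme X n) : Type _ := Quotient R.dualSetoid

/-- The class of a character in the dual scheme. -/
noncomputable def dualClass (R : AssocScheme X n) (χ : AddChar X ℂ) : R.DualClass :=
  Quotient.mk R.dualSetoid χ

/-- The `γ`-component `∑_i a_i Q_γ(i)` of the dual (MacWilliams) distribution of a code `C` with
inner distribution `a_i = |R_i ∩ C²| / |C|`; here `Q_γ(i) = ∑_{χ ∈ γ} χ (y - x)` whenever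
`(x, y) ∈ R_i`, so that it is `|C|⁻¹ ∑_{x, y ∈ C} ∑_{χ ∈ γ} χ (y - x)`. -/
noncomputable def dualDistribution (R : AssocScheme X n) (C : Set X) (γ : R.DualClass) : ℂ :=
  (C.ncard : ℂ)⁻¹ *
    ∑ᶠ x ∈ C, ∑ᶠ y ∈ C, ∑ᶠ χ ∈ {χ : AddChar X ℂ | R.dualClass χ = γ}, χ (y - x)

/-- The (classical) external distance of a code: the number of nonzero components of its dual
distribution, the one of the trivial class excluded. -/
noncomputable def externalDistance (R : AssocScheme X n) (C : Set X) : ℕ :=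
  {γ : R.DualClass | γ ≠ R.dualClass 0 ∧ R.dualDistribution C γ ≠ 0}.ncard

/-- For an identification `φ` of `X` with its character group: the number of nontrivial classes
of the dual scheme met by (the image of) the subgroup `Y`, that is, the number of nontrivial
relations of the dual scheme which occur between elements of `Y`. -/
noncomputable def dualDegree (R : AssocScheme X n) (φ : X ≃+ AddChar X ℂ)
    (Y : AddSubgroup X) : ℕ :=
  {γ : R.DualClass | γ ≠ R.dualClass 0 ∧
    ∃ a ∈ Y, ∃ b ∈ Y, R.dualClass (φ b - φ a) = γ}.ncard

/-- `φ` identifies the translation scheme with its dual: it maps the partition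
`{X_i}` of `X` to the dual partition of the character group. -/
def IsSelfDualVia (R : AssocScheme X n) (φ : X ≃+ AddChar X ℂ) : Prop :=
  ∀ x y, (∃ i, x ∈ R.cls i ∧ y ∈ R.cls i) ↔ R.dualClass (φ x) = R.dualClass (φ y)

/-- The generalized external distance `s' - Π(e) + e + 1` of a code `C` with packing radius `e`,
where `Π` is the dispersion function `Pi`. -/
noncomputable def genExternalDistance (R : AssocScheme X n) (Pi : ℝ → ℕ) (C : Set X)
    (e : ℕ) : ℤ :=
  (R.externalDistance C : ℤ) - (Pi e : ℤ) + (e : ℤ) + 1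

end AssocScheme

/-- The dispersion function `Π(e)`: the number of indices `i` with `0 ≤ d(i) ≤ e`. -/
noncomputable def dispersion {n : ℕ} (δ : Fin (n + 1) → ℝ) (e : ℝ) : ℕ :=
  {i : Fin (n + 1) | 0 ≤ δ i ∧ δ i ≤ e}.ncard

/-- A distance is graphical if whenever `d x y > 1` there is `z` with `d x z = d x y - 1` and
`d z y = 1`. -/
def IsGraphical {X : Type*} (d : X → X → ℝ) : Prop :=
  ∀ x y, 1 < d x y → ∃ z, d x z = d x y - 1 ∧ d z y = 1

/-- The ball `B(c, e) = {y | d(y, c) ≤ e}`. -/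
def codeBall {X : Type*} (d : X → X → ℝ) (c : X) (e : ℝ) : Set X := {y | d y c ≤ e}

/-- `e` is the packing radius of `C`: the largest integer for which the balls of radius `e`
around the elements of `C` are pairwise disjoint. For a code with a single element, where
there is no largest one, every `e` is accepted. -/
def IsPackingRadius {X : Type*} (d : X → X → ℝ) (C : Set X) (e : ℕ) : Prop :=
  C.PairwiseDisjoint (fun c => codeBall d c e) ∧
    (C.Nontrivial → ¬ C.PairwiseDisjoint (fun c => codeBall d c ((e : ℝ) + 1)))

/-- The dual `Y^⊥ = {x | φ(y)(x) = 1 for all y ∈ Y}` of a subgroup `Y`, with respect to an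
identification `φ` of `X` with its character group. -/
def perp {X : Type*} [AddCommGroup X] (φ : X ≃+ AddChar X ℂ) (Y : AddSubgroup X) :
    AddSubgroup X where
  carrier := {x | ∀ y ∈ Y, φ y x = 1}
  zero_mem' := fun _ _ => AddChar.map_zero_eq_one _
  add_mem' := fun {a b} ha hb y hy => by
    rw [AddChar.map_add_eq_mul, ha y hy, hb y hy, mul_one]
  neg_mem' := fun {a} ha y hy => by
    have h := AddChar.map_add_eq_mul (φ y) (-a) a
    rw [neg_add_cancel, AddChar.map_zero_eq_one, ha y hy, mul_one] at h
    exact h.symm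

/-! Since `|Y| |Y^⊥| = |X|`, the bound says that balls of radius `μ'` around `Y^⊥` cover `X`
(`card_le_sum_valency`), so the point is to bound the covering radius of `Y^⊥` by `μ'`
(`exists_perp_dist_le`).

This comes from the rank of the outer distribution, the matrix counting the codewords in relation
`i` to `x`. By Fourier inversion its columns lie in the span of one function per dual class met by
`Y`, hence the rank is at most `s + 1` (`card_le_dualDegree_add_one`). In the other direction,
disjointness of the balls of radius `e` makes the `Π(e)` columns with `δ i ≤ e` independent, and
each further distance from the code that is attained beyond `e` adds one more (`dispersion_add_le`).
A point farther than `μ'` would, by graphicality, yield too many such distances.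

The value of `μ'` follows from double duality: the characters trivial on `Y^⊥` are those coming from
`Y`. -/

/-! ### Character sums and duality of subgroups -/

open scoped Classical in
theorem sum_subgroup_apply_eq_ite {X : Type*} [AddCommGroup X] [Fintype X]
    (φ : X ≃+ AddChar X ℂ) (Y : AddSubgroup X) (x : X) :
    ∑ y : Y, φ y x = if x ∈ perp φ Y then (Nat.card Y : ℂ) else 0 := by
  let ψ : AddChar Y ℂ :=
    { toFun := fun y => φ y x
      map_zero_eq_one' := by simp
      map_add_eq_mul' := fun a b => by simp }
  have hψ : ψ = 0 ↔ x ∈ perp φ Y := by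
    constructor
    · intro h y hy
      exact DFunLike.congr_fun h (⟨y, hy⟩ : Y)
    · intro h
      ext y
      exact h y y.2
  have h := AddChar.sum_eq_ite ψ
  simp only [hψ] at h
  rw [Nat.card_eq_fintype_card]
  exact h

-- Evaluate `∑ x, ∑ y : Y, (φ y - χ) x` in both orders: summing over `y` first leaves only `x ∈
-- Y^⊥`, summing over `x` first leaves only `φ y = χ`.
open scoped Classical in
theorem card_mul_sum_perp {X : Type*} [AddCommGroup X] [Fintype X]
    (φ : X ≃+ AddChar X ℂ) (Y : AddSubgroup X) (χ : AddChar X ℂ) :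
    (Nat.card Y : ℂ) * ∑ c : perp φ Y, χ (-c) =
      if ∃ y ∈ Y, φ y = χ then (Nat.card X : ℂ) else 0 := by
  have h1 : (Nat.card Y : ℂ) * ∑ c : perp φ Y, χ (-c) = ∑ x : X, ∑ y : Y, (φ y - χ) x := by
    have h : ∀ x : X, ∑ y : Y, (φ y - χ) x =
        if x ∈ perp φ Y then (Nat.card Y : ℂ) * χ (-x) else 0 := by
      intro x
      simp only [AddChar.sub_apply]
      rw [← Finset.sum_mul, sum_subgroup_apply_eq_ite]
      split_ifs <;> simp
    simp only [h]
    rw [← Finset.sum_filter, Finset.mul_sum]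
    exact (Finset.sum_subtype (p := fun x => x ∈ perp φ Y) _ (by simp)
      (fun x : X => (Nat.card Y : ℂ) * χ (-x))).symm
  rw [h1, Finset.sum_comm]
  simp only [AddChar.sum_eq_ite, sub_eq_zero, Nat.card_eq_fintype_card]
  split_ifs with h
  · obtain ⟨y, hy, rfl⟩ := h
    rw [Finset.sum_eq_single (⟨y, hy⟩ : Y)]
    · simp
    · intro b _ hb
      rw [if_neg]
      intro h
      exact hb (Subtype.ext (φ.injective h))
    · simp
  · exact Finset.sum_eq_zero fun y _ => if_neg fun hy => h ⟨y, y.2, hy⟩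

theorem card_mul_card_perp {X : Type*} [AddCommGroup X] [Fintype X]
    (φ : X ≃+ AddChar X ℂ) (Y : AddSubgroup X) :
    Nat.card Y * Nat.card (perp φ Y) = Nat.card X := by
  classical
  have h := card_mul_sum_perp φ Y 0
  rw [if_pos ⟨0, Y.zero_mem, map_zero φ⟩] at h
  simp only [AddChar.zero_apply, Finset.sum_const, Finset.card_univ, nsmul_eq_mul, mul_one] at h
  rw [Nat.card_eq_fintype_card (α := perp φ Y)]
  exact_mod_cast h

/-- Double duality: the characters which are trivial on `Y^⊥` are those coming from `Y`. -/
theorem forall_mem_perp_eq_one_iff {X : Type*} [AddCommGroup X] [Fintype X]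
    (φ : X ≃+ AddChar X ℂ) (Y : AddSubgroup X) (χ : AddChar X ℂ) :
    (∀ c ∈ perp φ Y, χ c = 1) ↔ ∃ y ∈ Y, φ y = χ := by
  classical
  constructor
  · intro h
    by_contra hne
    have h' := card_mul_sum_perp φ Y χ
    rw [if_neg hne, Finset.sum_congr rfl
      (fun (c : perp φ Y) _ => h (-c) ((perp φ Y).neg_mem c.2))] at h'
    simp [Nat.card_eq_fintype_card] at h'
  · rintro ⟨y, hy, rfl⟩ c hc
    exact hc y hy

open scoped Classical in
theorem sum_sum_subgroup_sub {X : Type*} [AddCommGroup X] [Fintype X]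
    (C : AddSubgroup X) (χ : AddChar X ℂ) :
    ∑ x : C, ∑ y : C, χ (y - x) =
      if ∀ c ∈ C, χ c = 1 then (Nat.card C : ℂ) * Nat.card C else 0 := by
  have h : ∀ x : C, ∑ y : C, χ (y - x) = ∑ y : C, χ y := by
    intro x
    exact Fintype.sum_equiv (Equiv.subRight x) _ _ fun y => by simp
  rw [Finset.sum_congr rfl fun x _ => h x]
  let ψ : AddChar C ℂ := χ.compAddMonoidHom C.subtype
  have hψ : ψ = 0 ↔ ∀ c ∈ C, χ c = 1 := by
    constructor
    · intro h c hc
      exact DFunLike.congr_fun h (⟨c, hc⟩ : C)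
    · intro h
      ext y
      exact h y y.2
  have hs := AddChar.sum_eq_ite ψ
  simp only [hψ] at hs
  have hs' : ∑ y : C, χ y = if ∀ c ∈ C, χ c = 1 then (Fintype.card C : ℂ) else 0 := hs
  rw [hs', Nat.card_eq_fintype_card]
  split_ifs <;> simp

/-! ### External distance of `Y^⊥` -/

namespace AssocScheme

/-- No cancellation can occur within a class: each character of `γ` contributes `|C|²` to the triple
sum if it is trivial on `C`, and `0` otherwise. -/
theorem dualDistribution_ne_zero_iff {X : Type*} {n : ℕ} [AddCommGroup X] [Fintype X]
    (R : AssocScheme X n) (C : AddSubgroup X) (γ : R.DualClass) :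
    R.dualDistribution (C : Set X) γ ≠ 0 ↔
      ∃ χ : AddChar X ℂ, R.dualClass χ = γ ∧ ∀ c ∈ C, χ c = 1 := by
  classical
  have hsum : ∑ᶠ x ∈ (C : Set X), ∑ᶠ y ∈ (C : Set X),
      ∑ᶠ χ ∈ {χ : AddChar X ℂ | R.dualClass χ = γ}, χ (y - x) =
      ((Finset.univ.filter fun χ : AddChar X ℂ =>
        R.dualClass χ = γ ∧ ∀ c ∈ C, χ c = 1).card : ℂ) * ((Nat.card C : ℂ) * Nat.card C) := by
    have h1 : ∀ f : X → ℂ, ∑ᶠ x ∈ (C : Set X), f x = ∑ x : C, f x := by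
      intro f
      rw [finsum_mem_eq_finite_toFinset_sum f (Set.toFinite _)]
      exact Finset.sum_subtype _ (by simp) f
    have h2 : ∀ f : AddChar X ℂ → ℂ,
        ∑ᶠ χ ∈ {χ : AddChar X ℂ | R.dualClass χ = γ}, f χ =
          ∑ χ ∈ Finset.univ.filter (fun χ => R.dualClass χ = γ), f χ := by
      intro f
      rw [finsum_mem_eq_finite_toFinset_sum f (Set.toFinite _)]
      exact Finset.sum_congr (by ext; simp) fun _ _ => rfl
    simp only [h1, h2]
    rw [Finset.sum_congr rfl fun x _ => Finset.sum_comm, Finset.sum_comm]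
    simp only [sum_sum_subgroup_sub]
    rw [← Finset.sum_filter, Finset.filter_filter, Finset.sum_const, nsmul_eq_mul]
  have hC : (Nat.card C : ℂ) ≠ 0 := by exact_mod_cast Nat.card_pos.ne'
  have hC' : ((C : Set X).ncard : ℂ) = Nat.card C := rfl
  rw [dualDistribution, hsum, hC']
  simp only [ne_eq, mul_eq_zero, inv_eq_zero, hC, or_false, false_or, Nat.cast_eq_zero,
    Finset.card_eq_zero, Finset.filter_eq_empty_iff]
  push Not
  simp

theorem dualDegree_eq {X : Type*} {n : ℕ} [AddCommGroup X] (R : AssocScheme X n)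
    (φ : X ≃+ AddChar X ℂ) (Y : AddSubgroup X) :
    R.dualDegree φ Y = {γ : R.DualClass | γ ≠ R.dualClass 0 ∧
      ∃ y ∈ Y, R.dualClass (φ y) = γ}.ncard := by
  unfold dualDegree
  congr 1
  ext γ
  refine and_congr_right fun _ => ⟨?_, ?_⟩
  · rintro ⟨a, ha, b, hb, h⟩
    exact ⟨b - a, Y.sub_mem hb ha, by rw [map_sub, h]⟩
  · rintro ⟨y, hy, h⟩
    exact ⟨0, Y.zero_mem, y, hy, by rw [map_zero, sub_zero, h]⟩

theorem externalDistance_perp {X : Type*} {n : ℕ} [AddCommGroup X] [Fintype X]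
    (R : AssocScheme X n) (φ : X ≃+ AddChar X ℂ) (Y : AddSubgroup X) :
    R.externalDistance (perp φ Y : Set X) = R.dualDegree φ Y := by
  rw [dualDegree_eq, externalDistance]
  congr 1
  ext γ
  refine and_congr_right fun _ => ?_
  rw [dualDistribution_ne_zero_iff]
  simp only [forall_mem_perp_eq_one_iff]
  constructor
  · rintro ⟨χ, h, y, hy, rfl⟩
    exact ⟨y, hy, h⟩
  · rintro ⟨y, hy, h⟩
    exact ⟨_, h, y, hy, rfl⟩

instance {X : Type*} {n : ℕ} [AddCommGroup X] [Finite X] (R : AssocScheme X n) :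
    Finite R.DualClass :=
  Quotient.finite _

theorem card_dualClass_subgroup {X : Type*} {n : ℕ} [AddCommGroup X] [Finite X]
    (R : AssocScheme X n) (φ : X ≃+ AddChar X ℂ) (Y : AddSubgroup X) :
    Nat.card {γ : R.DualClass // ∃ y ∈ Y, R.dualClass (φ y) = γ} = R.dualDegree φ Y + 1 := by
  rw [dualDegree_eq, ← Set.ncard_insert_of_notMem (a := R.dualClass 0) (by simp)]
  change Set.ncard {γ : R.DualClass | ∃ y ∈ Y, R.dualClass (φ y) = γ} = _
  congr 1
  ext γ
  by_cases h : γ = R.dualClass 0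
  · simp only [Set.mem_ofPred_eq, Set.mem_insert_iff, h, true_or, iff_true]
    exact ⟨0, Y.zero_mem, by rw [map_zero]⟩
  · simp [h]

theorem rel_iff_sub_mem_cls {X : Type*} {n : ℕ} [AddCommGroup X] {R : AssocScheme X n}
    (hR : R.IsTranslation) (i : Fin (n + 1)) (x y : X) : R.rel i x y ↔ y - x ∈ R.cls i := by
  rw [hR i x y (-x), cls, Set.mem_ofPred_eq, add_neg_cancel, sub_eq_add_neg]

end AssocScheme

/-! ### Rank of the outer distribution -/

/-- Functions lying in the span of `κ` functions, and admitting evaluation points at which they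
form a triangular matrix with nonzero diagonal, are at most `|κ|` in number. -/
theorem card_le_of_triangular {ι κ X K : Type*} [Fintype ι] [Fintype κ] [Field K]
    (v : ι → X → K) (F : κ → X → K) (a : ι → κ → K)
    (hv : ∀ i x, v i x = ∑ k, a i k * F k x) (p : ι → X) (r : ι → ℕ)
    (hdiag : ∀ i, v i (p i) ≠ 0) (hoff : ∀ i j, i ≠ j → r j ≤ r i → v j (p i) = 0) :
    Fintype.card ι ≤ Fintype.card κ := by
  classical
  -- It suffices that the coefficient vectors are independent, since they live in the
  -- `|κ|`-dimensional space `κ → K`.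
  have hli : LinearIndependent K a := by
    rw [Fintype.linearIndependent_iff]
    intro g hg
    have hx : ∀ x, ∑ i, g i * v i x = 0 := by
      intro x
      simp only [hv, Finset.mul_sum]
      rw [Finset.sum_comm]
      refine Finset.sum_eq_zero fun k _ => ?_
      have hk := congrFun hg k
      simp only [Finset.sum_apply, Pi.smul_apply, smul_eq_mul, Pi.zero_apply] at hk
      simp only [← mul_assoc]
      rw [← Finset.sum_mul, hk, zero_mul]
    by_contra! hne
    obtain ⟨i₀, hi₀⟩ := hne
    -- At the point of maximal rank among the nonzero coefficients, every other term vanishes.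
    obtain ⟨i, hi, hmax⟩ := Finset.exists_max_image (Finset.univ.filter fun i => g i ≠ 0) r
      ⟨i₀, by simpa using hi₀⟩
    have h := hx (p i)
    rw [Finset.sum_eq_single i] at h
    · rcases mul_eq_zero.1 h with h | h
      · simp [h] at hi
      · exact hdiag i h
    · intro j _ hji
      by_cases hj : g j = 0
      · rw [hj, zero_mul]
      · rw [hoff i j hji.symm (hmax j (by simpa using hj)), mul_zero]
    · simp
  simpa using hli.fintype_card_le_finrank

namespace AssocScheme

-- Poisson summation: expand the indicator of `Y^⊥` in the characters `φ y`. The coefficients are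
-- the eigenvalues of `R_i`.
open scoped Classical in
theorem card_mul_sum_cls_perp {X : Type*} {n : ℕ} [AddCommGroup X] [Fintype X]
    (R : AssocScheme X n) (φ : X ≃+ AddChar X ℂ) (Y : AddSubgroup X) (i : Fin (n + 1)) (x : X) :
    (Nat.card Y : ℂ) * ((Finset.univ.filter fun z => z ∈ R.cls i ∧ x + z ∈ perp φ Y).card : ℂ) =
      ∑ y : Y, (∑ᶠ z ∈ R.cls i, φ y z) * φ y x := by
  have h1 : ∀ χ : AddChar X ℂ, ∑ᶠ z ∈ R.cls i, χ z =
      ∑ z ∈ Finset.univ.filter (fun z => z ∈ R.cls i), χ z := by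
    intro χ
    rw [finsum_mem_eq_finite_toFinset_sum _ (Set.toFinite _)]
    exact Finset.sum_congr (by ext; simp) fun _ _ => rfl
  simp only [h1, Finset.sum_mul, ← AddChar.map_add_eq_mul]
  rw [Finset.sum_comm]
  simp only [sum_subgroup_apply_eq_ite]
  rw [← Finset.sum_filter, Finset.filter_filter, Finset.sum_const, nsmul_eq_mul, mul_comm]
  simp only [add_comm x]

/-- The rank of the outer distribution of `Y^⊥` is at most `s + 1`. -/
theorem card_le_dualDegree_add_one {X : Type*} {n : ℕ} [AddCommGroup X] [Fintype X]
    {R : AssocScheme X n} (hR : R.IsTranslation) (φ : X ≃+ AddChar X ℂ) (Y : AddSubgroup X)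
    {ι : Type*} [Fintype ι] (f : ι → Fin (n + 1)) (p : ι → X) (r : ι → ℕ)
    (hdiag : ∀ i, ∃ c ∈ perp φ Y, R.rel (f i) (p i) c)
    (hoff : ∀ i j, i ≠ j → r j ≤ r i → ∀ c ∈ perp φ Y, ¬ R.rel (f j) (p i) c) :
    Fintype.card ι ≤ R.dualDegree φ Y + 1 := by
  classical
  have := Fintype.ofFinite {γ : R.DualClass // ∃ y ∈ Y, R.dualClass (φ y) = γ}
  rw [← card_dualClass_subgroup, Nat.card_eq_fintype_card]
  have hY : (Nat.card Y : ℂ) ≠ 0 := by exact_mod_cast Nat.card_pos.ne'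
  refine card_le_of_triangular
    (fun i x => (Nat.card Y : ℂ) *
      ((Finset.univ.filter fun z => z ∈ R.cls (f i) ∧ x + z ∈ perp φ Y).card : ℂ))
    (fun γ x => ∑ y : Y, if R.dualClass (φ y) = γ.1 then φ y x else 0)
    (fun i γ => ∑ᶠ z ∈ R.cls (f i), Quotient.out γ.1 z) ?_ p r ?_ ?_
  · intro i x
    rw [card_mul_sum_cls_perp]
    simp only [Finset.mul_sum]
    rw [Finset.sum_comm]
    refine Finset.sum_congr rfl fun y _ => ?_
    rw [Finset.sum_eq_single ⟨R.dualClass (φ y), y, y.2, rfl⟩]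
    · rw [if_pos rfl]
      congr 1
      -- The eigenvalue is constant on a dual class by definition, so any representative will do.
      exact (Quotient.exact (Quotient.out_eq (R.dualClass (φ y))) (f i)).symm
    · intro γ _ hγ
      rw [if_neg, mul_zero]
      intro h
      exact hγ (Subtype.ext h.symm)
    · simp
  · intro i
    obtain ⟨c, hc, h⟩ := hdiag i
    refine mul_ne_zero hY (Nat.cast_ne_zero.2 (Finset.card_ne_zero.2 ⟨c - p i, ?_⟩))
    simpa [hc] using (rel_iff_sub_mem_cls hR _ _ _).1 h
  · intro i j hij hr
    refine mul_eq_zero_of_right _ (Nat.cast_eq_zero.2 (Finset.card_eq_zero.2 ?_))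
    rw [Finset.filter_eq_empty_iff]
    rintro z - ⟨hz, hc⟩
    refine hoff i j hij hr _ hc ((rel_iff_sub_mem_cls hR _ _ _).2 ?_)
    rwa [add_sub_cancel_left]

end AssocScheme

/-! ### Graphical distances and valencies -/

/-- In a graphical distance, the points between `x` and `c` at integral distance from `c`. -/
theorem IsGraphical.exists_between {X : Type*} {d : X → X → ℝ} (hg : IsGraphical d)
    (htri : ∀ x y z, d x z ≤ d x y + d y z) {x c : X} {k : ℕ} (hk : 1 ≤ k)
    (hkd : (k : ℝ) < d x c) : ∃ z, d x z = d x c - k ∧ d z c ≤ k := by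
  induction k, hk using Nat.le_induction with
  | base =>
    obtain ⟨z, h1, h2⟩ := hg x c (by simpa using hkd)
    exact ⟨z, by simpa using h1, by simpa using h2.le⟩
  | succ k hk ih =>
    push_cast at hkd ⊢
    obtain ⟨z, h1, h2⟩ := ih (by linarith)
    obtain ⟨w, h3, h4⟩ := hg x z (by linarith)
    exact ⟨w, by linarith, by linarith [htri w z c]⟩

namespace AssocScheme

theorem exists_rel {X : Type*} {n : ℕ} (R : AssocScheme X n) (x y : X) : ∃ i, R.rel i x y :=
  (R.partition x y).exists

theorem rel_unique {X : Type*} {n : ℕ} (R : AssocScheme X n) {x y : X} {i j : Fin (n + 1)}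
    (hi : R.rel i x y) (hj : R.rel j x y) : i = j :=
  (R.partition x y).unique hi hj

theorem inv_inv {X : Type*} {n : ℕ} (R : AssocScheme X n) (i : Fin (n + 1)) :
    R.inv (R.inv i) = i := by
  obtain ⟨x, y, h⟩ := R.nonempty i
  exact R.rel_unique ((R.rel_inv _ _ _).2 ((R.rel_inv _ _ _).2 h)) h

theorem valency_inv {X : Type*} {n : ℕ} (R : AssocScheme X n) (i : Fin (n + 1)) :
    R.valency (R.inv i) = R.valency i := by
  rw [valency, valency, inv_inv, p_comm]

/-- Balls have their centre as second argument of a possibly asymmetric `d`, so relations must be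
counted from the left as well; commutativity gives the same number. -/
theorem ncard_rel_left {X : Type*} {n : ℕ} (R : AssocScheme X n) (i : Fin (n + 1)) (c : X) :
    {x : X | R.rel i x c}.ncard = R.valency i := by
  rw [← valency_inv, ← R.ncard_rel_eq_valency _ c]
  simp only [R.rel_inv]

theorem cls_nonempty {X : Type*} {n : ℕ} [AddCommGroup X] {R : AssocScheme X n}
    (hR : R.IsTranslation) (i : Fin (n + 1)) : (R.cls i).Nonempty := by
  obtain ⟨x, y, h⟩ := R.nonempty i
  exact ⟨y - x, (rel_iff_sub_mem_cls hR _ _ _).1 h⟩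

/-! ### Covering radius of `Y^⊥` and the counting bound -/

section Covering

variable {X : Type*} {n : ℕ} [AddCommGroup X] [Fintype X] {R : AssocScheme X n}
  {d : X → X → ℝ} {δ : Fin (n + 1) → ℝ}

/-- If `e` is at most the packing radius of `Y^⊥`, and `k` points lie at pairwise different
distances greater than `e` from `Y^⊥` (attained at the codewords `c j`), then
`Π(e) + k ≤ s + 1`. -/
theorem dispersion_add_le (hR : R.IsTranslation) (hd : R.IsWeaklyMetric d δ)
    (φ : X ≃+ AddChar X ℂ) (Y : AddSubgroup X) {e : ℕ}
    (he : (perp φ Y : Set X).PairwiseDisjoint (fun c => codeBall d c e))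
    {k : ℕ} (p : Fin k → X) (c : Fin k → X) (hc : ∀ j, c j ∈ perp φ Y)
    (hmin : ∀ j, ∀ c' ∈ perp φ Y, d (p j) (c j) ≤ d (p j) c')
    (hmono : StrictMono fun j => d (p j) (c j)) (hgt : ∀ j, e < d (p j) (c j)) :
    dispersion δ e + k ≤ R.dualDegree φ Y + 1 := by
  classical
  have hw : ∀ i : Fin (n + 1), ∃ x, R.rel i x 0 := by
    intro i
    obtain ⟨x, hx⟩ := cls_nonempty hR (R.inv i)
    exact ⟨x, (R.rel_inv i 0 x).1 hx⟩
  choose w hw using hw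
  choose g hg using fun j => R.exists_rel (p j) (c j)
  have hcard : Fintype.card ({i : Fin (n + 1) // 0 ≤ δ i ∧ δ i ≤ e} ⊕ Fin k) =
      dispersion δ e + k := by
    rw [Fintype.card_sum, Fintype.card_fin, ← Nat.card_eq_fintype_card]
    rfl
  rw [← hcard]
  refine card_le_dualDegree_add_one hR φ Y (Sum.elim (fun i => i.1) g)
    -- All near relations share rank `0`: at `w i` the only codeword within `e` is `0`, so their
    -- block is diagonal. The far points are ranked by their distance to the code.
    (Sum.elim (fun i => w i.1) p) (Sum.elim (fun _ => 0) fun j => j.1 + 1) ?_ ?_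
  · rintro (i | j)
    · exact ⟨0, (perp φ Y).zero_mem, hw i.1⟩
    · exact ⟨c j, hc j, hg j⟩
  · rintro (i | i) (j | j) hij hr c' hc' hrel
    · simp only [Sum.elim_inl] at hrel
      have h0 : (0 : X) = c' := by
        by_contra hne
        refine Set.disjoint_left.1 (he (perp φ Y).zero_mem hc' hne) (?_ : w i.1 ∈ _) ?_
        · exact (hd.const _ _ _ (hw i.1)).trans_le i.2.2
        · exact (hd.const _ _ _ hrel).trans_le j.2.2
      subst h0
      exact hij (congrArg Sum.inl (Subtype.ext (R.rel_unique (hw i.1) hrel)))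
    · simp at hr
    · simp only [Sum.elim_inl, Sum.elim_inr] at hrel
      have h1 := hd.const _ _ _ hrel
      linarith [hmin i c' hc', hgt i, j.2.2]
    · simp only [Sum.elim_inr] at hrel hr
      have h1 := hd.const _ _ _ hrel
      have h2 := hd.const _ _ _ (hg j)
      have hji : j < i := lt_of_le_of_ne (Fin.le_def.2 (by omega)) fun h => hij (by rw [h])
      have h3 : d (p j) (c j) < d (p i) (c i) := hmono hji
      linarith [hmin i c' hc']

/-- The covering radius of `Y^⊥` is at most its generalized external distance. -/
theorem exists_perp_dist_le (hR : R.IsTranslation) (hd : R.IsWeaklyMetric d δ)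
    (hg : IsGraphical d) (φ : X ≃+ AddChar X ℂ) (Y : AddSubgroup X) {e : ℕ}
    (he : (perp φ Y : Set X).PairwiseDisjoint (fun c => codeBall d c e)) (x : X) :
    ∃ c ∈ perp φ Y,
      d x c ≤ (((R.dualDegree φ Y : ℤ) - (dispersion δ e : ℤ) + (e : ℤ) + 1 : ℤ) : ℝ) := by
  -- With no far points this gives `Π(e) ≤ s + 1`, so that `μ' = e + k` with `k` a natural number.
  have h0 : dispersion δ e + 0 ≤ R.dualDegree φ Y + 1 :=
    dispersion_add_le hR hd φ Y he Fin.elim0 Fin.elim0 (fun j => j.elim0) (fun j => j.elim0)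
      (fun j => j.elim0) (fun j => j.elim0)
  obtain ⟨k, hk⟩ := Nat.exists_eq_add_of_le h0
  have hμ : ((R.dualDegree φ Y : ℤ) - (dispersion δ e : ℤ) + (e : ℤ) + 1) = ((e + k : ℕ) : ℤ) := by
    push_cast
    omega
  rw [hμ, Int.cast_natCast]
  by_contra! hfar
  obtain ⟨c, hc, hmin⟩ := Set.exists_min_image (perp φ Y : Set X) (d x) (Set.toFinite _)
    ⟨0, (perp φ Y).zero_mem⟩
  have hxc := hfar c hc
  have hlev : ∀ j : Fin k, ∃ z, d x z = d x c - (e + j + 1 : ℕ) ∧ d z c ≤ (e + j + 1 : ℕ) := by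
    intro j
    refine hg.exists_between hd.triangle (by omega) (lt_of_le_of_lt ?_ hxc)
    exact_mod_cast (by omega : e + j + 1 ≤ e + k)
  choose z hz1 hz2 using hlev
  -- A codeword closer to `z j` would be closer to `x` than the nearest codeword `c`.
  have hz : ∀ j : Fin k, ∀ c' ∈ perp φ Y, ((e + j + 1 : ℕ) : ℝ) ≤ d (z j) c' := by
    intro j c' hc'
    linarith [hd.triangle x (z j) c', hmin c' hc', hz1 j]
  have hzc : ∀ j : Fin k, d (z j) c = (e + j + 1 : ℕ) := fun j => le_antisymm (hz2 j) (hz j c hc)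
  -- The `z j` realise the distances `e + 1, …, e + k`, and `x` itself is one more far point,
  -- exceeding the rank bound by one.
  have key : dispersion δ e + (k + 1) ≤ R.dualDegree φ Y + 1 := by
    refine dispersion_add_le hR hd φ Y he (Fin.snoc z x : Fin (k + 1) → X) (fun _ => c)
      (fun _ => hc) ?_ ?_ ?_
    · intro j
      refine Fin.lastCases ?_ (fun j => ?_) j
      · simpa using hmin
      · simpa [hzc] using hz j
    · intro i j
      refine Fin.lastCases ?_ (fun j => ?_) j
      · refine Fin.lastCases (fun h => absurd h (lt_irrefl _)) (fun i _ => ?_) i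
        simp only [Fin.snoc_castSucc, Fin.snoc_last, hzc]
        refine lt_of_le_of_lt ?_ hxc
        exact_mod_cast (by omega : e + i + 1 ≤ e + k)
      · refine Fin.lastCases (fun h => absurd h (Fin.castSucc_lt_last j).not_gt)
          (fun i hij => ?_) i
        simp only [Fin.snoc_castSucc, hzc]
        have : (i : ℕ) < j := hij
        exact_mod_cast (by omega : e + i + 1 < e + j + 1)
    · intro j
      refine Fin.lastCases ?_ (fun j => ?_) j
      · simp only [Fin.snoc_last]
        refine lt_of_le_of_lt ?_ hxc
        exact_mod_cast Nat.le_add_right e k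
      · simp only [Fin.snoc_castSucc, hzc]
        exact_mod_cast (by omega : e < e + j + 1)
  omega

theorem ncard_codeBall (hd : R.IsWeaklyMetric d δ) (c : X) (t : ℝ) :
    (codeBall d c t).ncard = ∑ᶠ i ∈ {i : Fin (n + 1) | δ i ≤ t}, R.valency i := by
  have h : codeBall d c t = ⋃ i ∈ {i : Fin (n + 1) | δ i ≤ t}, {x | R.rel i x c} := by
    ext x
    simp only [codeBall, Set.mem_ofPred_eq, Set.mem_iUnion, exists_prop]
    constructor
    · intro hx
      obtain ⟨i, hi⟩ := R.exists_rel x c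
      exact ⟨i, (hd.const _ _ _ hi) ▸ hx, hi⟩
    · rintro ⟨i, hi, hx⟩
      exact (hd.const _ _ _ hx).trans_le hi
  have hdisj : ({i : Fin (n + 1) | δ i ≤ t}).PairwiseDisjoint
      (fun i => {x : X | R.rel i x c}) := by
    intro i _ j _ hij
    exact Set.disjoint_left.2 fun x hi hj => hij (R.rel_unique hi hj)
  rw [h, (Set.toFinite _).ncard_biUnion (fun _ _ => Set.toFinite _) hdisj]
  simp only [ncard_rel_left]

theorem card_le_sum_valency (hd : R.IsWeaklyMetric d δ) (φ : X ≃+ AddChar X ℂ)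
    (Y : AddSubgroup X) {t : ℝ} (hcov : ∀ x, ∃ c ∈ perp φ Y, d x c ≤ t) :
    Nat.card Y ≤ ∑ᶠ i ∈ {i : Fin (n + 1) | δ i ≤ t}, R.valency i := by
  classical
  refine Nat.le_of_mul_le_mul_right (c := Nat.card (perp φ Y)) ?_ Nat.card_pos
  rw [card_mul_card_perp, ← Set.ncard_univ]
  have huniv : (Set.univ : Set X) = ⋃ c : perp φ Y, codeBall d (c : X) t := by
    symm
    rw [Set.eq_univ_iff_forall]
    intro x
    obtain ⟨c, hc, h⟩ := hcov x
    exact Set.mem_iUnion.2 ⟨⟨c, hc⟩, h⟩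
  rw [huniv]
  calc (⋃ c : perp φ Y, codeBall d (c : X) t).ncard
      ≤ ∑ c : perp φ Y, (codeBall d (c : X) t).ncard := by
        simpa using Set.ncard_iUnion_le_of_fintype fun c : perp φ Y => codeBall d (c : X) t
    _ = _ := by
        simp only [ncard_codeBall hd, Finset.sum_const, Finset.card_univ, smul_eq_mul,
          Nat.card_eq_fintype_card, mul_comm]

end Covering

/-- Self-duality makes `i ↦ R.dualClass (φ (w i))`, for representatives `w i ∈ X_i`, an injection
that takes `0` to the trivial class and the relations met by `Y` onto the dual classes met by `Y`.
-/
theorem degree_eq_dualDegree {X : Type*} {n : ℕ} [AddCommGroup X] {R : AssocScheme X n}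
    (hR : R.IsTranslation) (φ : X ≃+ AddChar X ℂ) (hφ : R.IsSelfDualVia φ)
    (Y : AddSubgroup X) : R.degree (Y : Set X) = R.dualDegree φ Y := by
  choose w hw using cls_nonempty hR
  have hcls : ∀ i x, x ∈ R.cls i ↔ R.dualClass (φ x) = R.dualClass (φ (w i)) := by
    intro i x
    rw [← hφ]
    constructor
    · exact fun h => ⟨i, h, hw i⟩
    · rintro ⟨j, hj, hj'⟩
      rwa [R.rel_unique (hw i) hj']
  have hw0 : w 0 = 0 := ((R.diag 0 (w 0)).1 (hw 0)).symm
  have hinj : Function.Injective fun i => R.dualClass (φ (w i)) := by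
    intro i j hij
    exact R.rel_unique (hw i) ((hcls j (w i)).2 hij)
  have h0 : R.dualClass 0 = R.dualClass (φ (w 0)) := by rw [hw0, map_zero]
  rw [degree, dualDegree_eq, ← Set.ncard_image_of_injective _ hinj]
  congr 1
  ext γ
  simp only [Set.mem_image, Set.mem_ofPred_eq, SetLike.mem_coe]
  constructor
  · rintro ⟨i, ⟨hi, a, ha, b, hb, hab⟩, rfl⟩
    refine ⟨fun h => hi (hinj (h.trans h0)), b - a, Y.sub_mem hb ha, ?_⟩
    exact (hcls _ _).1 ((rel_iff_sub_mem_cls hR _ _ _).1 hab)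
  · rintro ⟨hγ, y, hy, rfl⟩
    obtain ⟨i, hi⟩ := R.exists_rel 0 y
    have hi' := (hcls i y).1 hi
    refine ⟨i, ⟨?_, 0, Y.zero_mem, y, hy, hi⟩, hi'.symm⟩
    rintro rfl
    exact hγ (hi'.trans h0.symm)

end AssocScheme

theorem mainTheorem8 {X : Type*} [AddCommGroup X] [Fintype X] [Nontrivial X] {n : ℕ}
    (R : AssocScheme X n) (hR : R.IsTranslation)
    (d : X → X → ℝ) (δ : Fin (n + 1) → ℝ) (hd : R.IsWeaklyMetric d δ) (hg : IsGraphical d)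
    (φ : X ≃+ AddChar X ℂ) (Y : AddSubgroup X)
    (s : ℕ) (hs : R.dualDegree φ Y = s)
    (e : ℕ) (he : IsPackingRadius d (perp φ Y : Set X) e) :
    (R.genExternalDistance (dispersion δ) (perp φ Y : Set X) e
        = (s : ℤ) - (dispersion δ e : ℤ) + (e : ℤ) + 1) ∧
    (Nat.card Y ≤
      ∑ᶠ i ∈ {i : Fin (n + 1) | δ i ≤ (((s : ℤ) - (dispersion δ e : ℤ) + (e : ℤ) + 1 : ℤ) : ℝ)},
        R.valency i) ∧
    (R.IsSelfDualVia φ → R.degree (Y : Set X) = s) := by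
  subst hs
  refine ⟨?_, ?_, ?_⟩
  · rw [AssocScheme.genExternalDistance, AssocScheme.externalDistance_perp]
  · exact AssocScheme.card_le_sum_valency hd φ Y
      (AssocScheme.exists_perp_dist_le hR hd hg φ Y he.1)
  · exact fun hφ => AssocScheme.degree_eq_dualDegree hR φ hφ Y
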